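/- \textbf{Theorem (cut-elimination).} Modal formulas are built from $\bot$ and atomic propositions $p$ by $A\to B$ and $\Box A$. A sequent $\Gamma\Rightarrow\Delta$ consists of two finite multisets of formulas, and $\Box\Pi$ denotes $\Box A_1,\dots,\Box A_n$ for $\Pi=A_1,\dots,A_n$. The calculus $\mathsf{Grz}_\infty$ has the initial sequents $\Gamma,p\Rightarrow p,\Delta$ (with $p$ atomic) and $\Gamma,\bot\Rightarrow\Delta$, and the rules $$\frac{\Gamma,B\Rightarrow\Delta\qquad \Gamma\Rightarrow A,\Delta}{\Gamma,A\to B\Rightarrow\Delta}\,(\to_L),\qquad \frac{\Gamma,A\Rightarrow B,\Delta}{\Gamma\Rightarrow A\to B,\Delta}\,(\to_R),$$ $$\frac{\Gamma,B,\Box B\Rightarrow\Delta}{\Gamma,\Box B\Rightarrow\Delta}\,(\mathsf{refl}),\qquad \frac{\Gamma,\Box\Pi\Rightarrow A,\Delta\qquad \Box\Pi\Rightarrow A}{\Gamma,\Box\Pi\Rightarrow\Box A,\Delta}\,(\Box).$$ The calculus $\mathsf{Grz}_\infty+\mathsf{cut}$ has in addition the rule $$\frac{\Gamma\Rightarrow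 A,\Delta\qquad \Gamma,A\Rightarrow\Delta}{\Gamma\Rightarrow\Delta}\,(\mathsf{cut}).$$ An $\infty$-proof in either calculus is a possibly infinite tree of sequents that is constructed according to the rules of the calculus, whose leaves are initial sequents, and in which every infinite branch passes through a right premise of the rule $(\Box)$ infinitely many times. A sequent is provable in the calculus if it is the root of some $\infty$-proof in it. If a sequent $\Gamma\Rightarrow\Delta$ is provable in $\mathsf{Grz}_\infty+\mathsf{cut}$, then it is provable in $\mathsf{Grz}_\infty$. -/

import Mathlib

namespace Grz

/-- Modal formulas over a set of atomic propositions: `⊥`, atoms, implications, boxes. -/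
inductive Formula (Atom : Type*) where
  | bot : Formula Atom
  | atom (p : Atom) : Formula Atom
  | imp (A B : Formula Atom) : Formula Atom
  | box (A : Formula Atom) : Formula Atom

/-- A sequent `Γ ⇒ Δ`, where `Γ` and `Δ` are finite multisets of formulas. -/
structure Sequent (Atom : Type*) where
  ant : Multiset (Formula Atom)
  suc : Multiset (Formula Atom)

/-- `□Γ`: prefix every member of the multiset `Γ` with a box (multiplicities are kept). -/
def boxes {Atom : Type*} (G : Multiset (Formula Atom)) : Multiset (Formula Atom) :=
  G.map Formula.box

/-- Instances of the initial sequents and inference rules of `Grz_∞ + cut`. -/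
inductive Inference (Atom : Type*) where
  /-- initial sequent `Γ, p ⇒ p, Δ` with `p` atomic -/
  | ax (G D : Multiset (Formula Atom)) (p : Atom)
  /-- initial sequent `Γ, ⊥ ⇒ Δ` -/
  | botL (G D : Multiset (Formula Atom))
  /-- from `Γ, B ⇒ Δ` and `Γ ⇒ A, Δ` infer `Γ, A → B ⇒ Δ` -/
  | impL (G D : Multiset (Formula Atom)) (A B : Formula Atom)
  /-- from `Γ, A ⇒ B, Δ` infer `Γ ⇒ A → B, Δ` -/
  | impR (G D : Multiset (Formula Atom)) (A B : Formula Atom)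
  /-- from `Γ, B, □B ⇒ Δ` infer `Γ, □B ⇒ Δ` -/
  | refl (G D : Multiset (Formula Atom)) (B : Formula Atom)
  /-- from `Γ, □Π ⇒ A, Δ` and `□Π ⇒ A` infer `Γ, □Π ⇒ □A, Δ` -/
  | box (G P D : Multiset (Formula Atom)) (A : Formula Atom)
  /-- from `Γ ⇒ A, Δ` and `Γ, A ⇒ Δ` infer `Γ ⇒ Δ` -/
  | cut (G D : Multiset (Formula Atom)) (A : Formula Atom)

namespace Inference

variable {Atom : Type*}

/-- The conclusion of an inference. -/
def conclusion : Inference Atom → Sequent Atom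
  | ax G D p => ⟨.atom p ::ₘ G, .atom p ::ₘ D⟩
  | botL G D => ⟨.bot ::ₘ G, D⟩
  | impL G D A B => ⟨.imp A B ::ₘ G, D⟩
  | impR G D A B => ⟨G, .imp A B ::ₘ D⟩
  | refl G D B => ⟨.box B ::ₘ G, D⟩
  | box G P D A => ⟨G + boxes P, .box A ::ₘ D⟩
  | cut G D _ => ⟨G, D⟩

/-- The premises of an inference, from left to right (none for an initial sequent). -/
def premises : Inference Atom → List (Sequent Atom)
  | ax _ _ _ => []
  | botL _ _ => []
  | impL G D A B => [⟨B ::ₘ G, D⟩, ⟨G, A ::ₘ D⟩]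
  | impR G D A B => [⟨A ::ₘ G, B ::ₘ D⟩]
  | refl G D B => [⟨B ::ₘ .box B ::ₘ G, D⟩]
  | box G P D A => [⟨G + boxes P, A ::ₘ D⟩, ⟨boxes P, {A}⟩]
  | cut G D A => [⟨G, A ::ₘ D⟩, ⟨A ::ₘ G, D⟩]

/-- The inference is an instance of the rule `(□)`. -/
def IsBox : Inference Atom → Prop
  | box _ _ _ _ => True
  | _ => False

/-- The inference is an instance of the cut rule. -/
def IsCut : Inference Atom → Prop
  | cut _ _ _ => True
  | _ => False

end Inference

/-- The system `Grz_∞ + cut`, given by its set of inferences. -/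
def GrzInfCut (Atom : Type*) : Set (Inference Atom) := Set.univ

/-- The system `Grz_∞`: all inferences other than cuts. -/
def GrzInf (Atom : Type*) : Set (Inference Atom) := {r | ¬ r.IsCut}

/-- An `∞`-proof over a set `S` of inferences. Nodes are addressed by finite sequences of child
numbers, the root by `[]` and the `i`-th child (from the left, from `0`) of `a` by `a ++ [i]`;
`node a = none` says that there is no node at `a`. A node carries the inference by which its
sequent, the conclusion of that inference, is obtained from the sequents at its children. -/
structure InfProof {Atom : Type*} (S : Set (Inference Atom)) where
  node : List ℕ → Option (Inference Atom)
  /-- the inference at the root -/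
  root : Inference Atom
  node_nil : node [] = some root
  node_none : ∀ a i, node a = none → node (a ++ [i]) = none
  /-- all inferences belong to the system -/
  mem : ∀ a r, node a = some r → r ∈ S
  /-- the children of a node are marked by exactly the premises of its inference -/
  premises : ∀ a r, node a = some r →
    ∀ i : ℕ, (node (a ++ [i])).map Inference.conclusion = r.premises[i]?
  /-- every infinite branch (choosing child `f n` at depth `n`) passes infinitely many times from
  the conclusion of an instance of `(□)` to its right premise -/
  branch : ∀ f : ℕ → ℕ, (∀ n, node ((List.range n).map f) ≠ none) →
    ∀ N, ∃ n, N ≤ n ∧ f n = 1 ∧ ∃ r, node ((List.range n).map f) = some r ∧ r.IsBox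

/-- A sequent is provable over `S` if it marks the root of some `∞`-proof over `S`. -/
def Provable {Atom : Type*} (S : Set (Inference Atom)) (s : Sequent Atom) : Prop :=
  ∃ π : InfProof S, π.root.conclusion = s

end Grz

/-!
The proof is semantic. Formulas are evaluated at well-founded trees of valuations, a box
quantifying over the subtrees of a tree, the tree itself included; these are Kripke models over
conversely well-founded partial orders.

*Soundness with cut* (`sound`). If the sequent at some node of an `∞`-proof is refuted at a tree `t`,
then so is a premise of its inference, except that for the rule `(□)` it may instead be the right
premise that is refuted, at a proper subtree of `t`. When `t` is minimal the exception cannot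
occur, and one obtains an infinite branch that passes through no further right premise of `(□)`.

*Completeness without cut* (`exists_inference`, `provable_of_unfolding`). Proof search is run on
states `Γ; Π ⇒ Δ`, in which the boxes of `Π` have already been unfolded by `(refl)`. A state counts
as refuted at `t` if `Γ` holds and `Δ` fails at `t` and `Π` holds at all *proper* subtrees of `t`.
An irrefutable state is the conclusion of an inference other than a cut whose premises are
irrefutable states again, of smaller weight except for right premises of `(□)`: if no such
inference existed, refutations of all sequents `□Π ⇒ A` with `□A` in `Δ` could be joined under a
new root to a refutation of the state. Unfolding these inferences forever gives an `∞`-proof, since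
the weight cannot decrease infinitely often in a row.
-/

namespace Grz

universe u

variable {Atom : Type u}

/-! ### Semantics in well-founded trees -/

/-- Well-founded trees whose nodes carry a valuation: the set `v` of atoms true at the root, and the
family `c` of immediate subtrees. Sets of formulas serve as index sets of the families, because in
the completeness argument the immediate subtrees correspond to the formulas that they refute. -/
inductive Tree (Atom : Type u) where
  | node (v : Set Atom) (I : Set (Formula Atom)) (c : I → Tree Atom) : Tree Atom

/-- The atoms true at the root of a tree. -/
def Tree.val : Tree Atom → Set Atom
  | node v _ _ => v

/-- `IsChild s t`: `s` is an immediate subtree of `t`. -/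
inductive IsChild : Tree Atom → Tree Atom → Prop
  | intro (v : Set Atom) (I : Set (Formula Atom)) (c : I → Tree Atom) (i : I) :
      IsChild (c i) (.node v I c)

/-- Truth of a formula at the root of a tree, a box quantifying over all subtrees. -/
def Force : Formula Atom → Tree Atom → Prop
  | .bot, _ => False
  | .atom p, t => p ∈ t.val
  | .imp A B, t => Force A t → Force B t
  | .box A, t => ∀ s, Relation.ReflTransGen IsChild s t → Force A s

/-- The sequent `Γ ⇒ Δ` is refuted at a tree: all of `Γ` is true there and all of `Δ` is false. -/
def Refutes (t : Tree Atom) (s : Sequent Atom) : Prop :=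
  (∀ F ∈ s.ant, Force F t) ∧ ∀ F ∈ s.suc, ¬ Force F t

theorem wellFounded_isChild : WellFounded (IsChild (Atom := Atom)) := by
  refine ⟨fun t => ?_⟩
  induction t with
  | node v I c ih => exact ⟨_, fun s hs => by cases hs; exact ih _⟩

theorem Force.of_box {A : Formula Atom} {t : Tree Atom} (h : Force (.box A) t) : Force A t :=
  h t .refl

theorem Force.box_mono {A : Formula Atom} {s t : Tree Atom} (h : Force (.box A) t)
    (hs : Relation.ReflTransGen IsChild s t) : Force (.box A) s :=
  fun r hr => h r (hr.trans hs)

theorem force_box_iff {A : Formula Atom} {t : Tree Atom} :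
    Force (.box A) t ↔ Force A t ∧ ∀ s, Relation.TransGen IsChild s t → Force A s := by
  refine ⟨fun h => ⟨h.of_box, fun s hs => h s hs.to_reflTransGen⟩, fun h s hs => ?_⟩
  rcases Relation.reflTransGen_iff_eq_or_transGen.1 hs with rfl | hs
  · exact h.1
  · exact h.2 s hs

/-! ### Soundness of the calculus with cut -/

/-- Local soundness: a refutation of the conclusion of an inference passes to one of the premises at
the same tree, or else to the right premise of `(□)` at a proper subtree. -/
theorem exists_premise_refuted (r : Inference Atom) (t : Tree Atom)
    (h : Refutes t r.conclusion) :
    (∃ i s, r.premises[i]? = some s ∧ ¬ (i = 1 ∧ r.IsBox) ∧ Refutes t s) ∨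
      ∃ t', Relation.TransGen IsChild t' t ∧ ∃ s, r.premises[1]? = some s ∧ Refutes t' s := by
  obtain ⟨hl, hr⟩ := h
  cases r with
  | ax G D p =>
    exact absurd (hl (.atom p) (by simp [Inference.conclusion]))
      (hr (.atom p) (by simp [Inference.conclusion]))
  | botL G D => exact (hl .bot (by simp [Inference.conclusion])).elim
  | impL G D A B =>
    simp only [Inference.conclusion, Multiset.mem_cons, forall_eq_or_imp] at hl hr
    left
    by_cases hA : Force A t
    · exact ⟨0, _, rfl, by simp, by simpa using ⟨hl.1 hA, hl.2⟩, hr⟩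
    · exact ⟨1, _, rfl, by simp [Inference.IsBox], hl.2, by simpa using ⟨hA, hr⟩⟩
  | impR G D A B =>
    simp only [Inference.conclusion, Multiset.mem_cons, forall_eq_or_imp, Force,
      Classical.not_imp] at hl hr
    exact .inl ⟨0, _, rfl, by simp, by simpa using ⟨hr.1.1, hl⟩, by simpa using ⟨hr.1.2, hr.2⟩⟩
  | refl G D B =>
    simp only [Inference.conclusion, Multiset.mem_cons, forall_eq_or_imp] at hl hr
    exact .inl ⟨0, _, rfl, by simp, by simpa using ⟨hl.1.of_box, hl⟩, hr⟩
  | box G P D A =>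
    simp only [Inference.conclusion, Multiset.mem_cons, forall_eq_or_imp] at hl hr
    by_cases hA : Force A t
    · right
      have := hr.1
      simp only [force_box_iff, hA, true_and, not_forall] at this
      obtain ⟨s, hs, hsA⟩ := this
      refine ⟨s, hs, _, rfl, fun F hF => ?_, by simpa using hsA⟩
      have hFt := hl F (Multiset.mem_add.2 (.inr hF))
      obtain ⟨B, -, rfl⟩ := Multiset.mem_map.1 hF
      exact hFt.box_mono hs.to_reflTransGen
    · exact .inl ⟨0, _, rfl, by simp, hl, by simpa using ⟨hA, hr.2⟩⟩
  | cut G D A =>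
    simp only [Inference.conclusion] at hl hr
    left
    by_cases hA : Force A t
    · exact ⟨1, _, rfl, by simp [Inference.IsBox], by simpa using ⟨hA, hl⟩, hr⟩
    · exact ⟨0, _, rfl, by simp, hl, by simpa using ⟨hA, hr⟩⟩

variable {S : Set (Inference Atom)}

/-- A property of nodes that is always inherited by some child, other than the right premise of an
instance of `(□)`, holds nowhere in an `∞`-proof. -/
theorem InfProof.not_of_step (π : InfProof S) (P : List ℕ → Prop)
    (hP : ∀ a, P a → π.node a ≠ none)
    (step : ∀ a, P a → ∃ i, P (a ++ [i]) ∧ ¬ (i = 1 ∧ ∃ r, π.node a = some r ∧ r.IsBox))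
    (a : List ℕ) : ¬ P a := by
  intro ha
  choose! next hnext using step
  let g : ℕ → List ℕ := fun n => Nat.rec a (fun _ b => b ++ [next b]) n
  have hg : ∀ n, P (g n) := fun n => by
    induction n with
    | zero => exact ha
    | succ n ih => exact (hnext _ ih).1
  let f : ℕ → ℕ := fun n => if h : n < a.length then a[n] else next (g (n - a.length))
  have hfa : ∀ n ≤ a.length, (List.range n).map f = a.take n := fun n hn => by
    refine List.ext_getElem (by simpa using hn) fun i h₁ h₂ => ?_
    have : i < a.length := by simp at h₂; omega
    simp [f, this]
  have hfg : ∀ n, (List.range (a.length + n)).map f = g n := fun n => by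
    induction n with
    | zero => simpa [g] using hfa _ le_rfl
    | succ n ih => rw [← add_assoc, List.range_succ, List.map_append, ih]; simp [f, g]
  -- All prefixes of an address of a node are addresses of nodes.
  have hmono : ∀ k n, π.node ((List.range (n + k)).map f) ≠ none →
      π.node ((List.range n).map f) ≠ none := fun k n => by
    induction k with
    | zero => exact id
    | succ k ih =>
      refine fun h => ih fun h' => h ?_
      rw [← add_assoc, List.range_succ, List.map_append]
      exact π.node_none _ _ h'
  obtain ⟨n, hn, hfn, hbox⟩ := π.branch f
    (fun n => hmono a.length n (by rw [add_comm, hfg]; exact hP _ (hg n))) a.length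
  obtain ⟨k, rfl⟩ := Nat.exists_eq_add_of_le hn
  rw [hfg] at hbox
  refine (hnext _ (hg k)).2 ⟨?_, hbox⟩
  simpa [f] using hfn

/-- Soundness: no sequent of an `∞`-proof is refuted at any tree, whether or not cuts occur. -/
theorem InfProof.sound (π : InfProof S) (t : Tree Atom) :
    ∀ a r, π.node a = some r → ¬ Refutes t r.conclusion := by
  induction t using wellFounded_isChild.transGen.induction with
  | _ t ih =>
    intro a r har href
    refine π.not_of_step (fun a => ∃ r, π.node a = some r ∧ Refutes t r.conclusion)
      (fun a ⟨r, hr, _⟩ => by simp [hr]) ?_ a ⟨r, har, href⟩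
    rintro a ⟨r, har, href⟩
    have child : ∀ i s, r.premises[i]? = some s →
        ∃ r', π.node (a ++ [i]) = some r' ∧ r'.conclusion = s := fun i s hs => by
      have := π.premises a r har i
      rw [hs] at this
      exact Option.map_eq_some_iff.1 this
    rcases exists_premise_refuted r t href with ⟨i, s, hs, hi, hts⟩ | ⟨t', ht', s, hs, hts⟩
    · obtain ⟨r', hr', rfl⟩ := child i s hs
      refine ⟨i, ⟨r', hr', hts⟩, fun ⟨h1, r₁, hr₁, hb⟩ => hi ⟨h1, ?_⟩⟩
      obtain rfl : r = r₁ := by simpa [har] using hr₁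
      exact hb
    · obtain ⟨r', hr', rfl⟩ := child 1 s hs
      exact (ih t' ht' _ r' hr' hts).elim

/-! ### Unfolding into `∞`-proofs -/

/-- Proof search yields an `∞`-proof as soon as every `x : X`, standing for the sequent `seq x`, is
obtained by an inference whose premises are given by elements of `X` again, of smaller weight unless
they are right premises of `(□)`. -/
theorem provable_of_unfolding {X : Type*} (seq : X → Sequent Atom) (weight : X → ℕ)
    (step : ∀ x, ∃ r ∈ S, r.conclusion = seq x ∧ ∀ (i : ℕ) q, r.premises[i]? = some q →
      ∃ y, seq y = q ∧ (weight y < weight x ∨ i = 1 ∧ r.IsBox)) (x : X) :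
    Provable S (seq x) := by
  choose inf hS hconc hprem using step
  have hnext : ∀ x i, ∃ o : Option X, o.map seq = (inf x).premises[i]? ∧
      ∀ y, o = some y → weight y < weight x ∨ i = 1 ∧ (inf x).IsBox := fun x i => by
    cases h : (inf x).premises[i]? with
    | none => exact ⟨none, rfl, by simp⟩
    | some q =>
      obtain ⟨y, rfl, hy⟩ := hprem x i q h
      exact ⟨some y, rfl, by rintro _ ⟨⟩; exact hy⟩
  choose next hseq hweight using hnext
  let state : List ℕ → Option X := fun a => a.foldl (fun o i => o.bind fun y => next y i) (some x)
  have state_append : ∀ a i, state (a ++ [i]) = (state a).bind fun y => next y i := fun a i => by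
    simp [state]
  refine ⟨{ node := fun a => (state a).map inf
            root := inf x
            node_nil := rfl
            node_none := fun a i h => ?_
            mem := fun a r h => ?_
            premises := fun a r h i => ?_
            branch := fun f hf N => ?_ }, hconc x⟩
  · rw [Option.map_eq_none_iff] at h
    simp [state_append, h]
  · obtain ⟨y, -, rfl⟩ := Option.map_eq_some_iff.1 h
    exact hS y
  · obtain ⟨y, hy, rfl⟩ := Option.map_eq_some_iff.1 h
    rw [state_append, hy, Option.bind_some, Option.map_map, ← hseq]
    congr 1
    exact funext hconc
  · by_contra! hN
    have hsome : ∀ n, ∃ y, state ((List.range n).map f) = some y := fun n =>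
      Option.ne_none_iff_exists'.1 fun h => hf n (by rw [h]; rfl)
    choose y hy using hsome
    refine not_strictAnti_of_wellFoundedLT (fun k => weight (y (N + k)))
      (strictAnti_nat_of_succ_lt fun k => ?_)
    have hk : next (y (N + k)) (f (N + k)) = some (y (N + k + 1)) := by
      have := hy (N + k + 1)
      rwa [List.range_succ, List.map_append, List.map_singleton, state_append, hy,
        Option.bind_some] at this
    refine (hweight _ _ _ hk).resolve_right fun ⟨h1, hb⟩ => ?_
    exact hN _ (by omega) h1 (inf (y (N + k))) (by rw [hy]; rfl) hb

/-! ### Completeness of the calculus without cut -/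

/-- The number of symbols of a formula. -/
def Formula.size : Formula Atom → ℕ
  | .bot => 1
  | .atom _ => 1
  | .imp A B => A.size + B.size + 1
  | .box A => A.size + 1

/-- A state `Γ; Π ⇒ Δ` of proof search stands for the sequent `Γ, □Π ⇒ Δ`, in which `(refl)` has
already been applied to the members of `□Π`. -/
structure State (Atom : Type u) where
  ant : Multiset (Formula Atom)
  unfolded : Multiset (Formula Atom)
  suc : Multiset (Formula Atom)

namespace State

/-- The sequent that a state stands for. -/
def toSequent (s : State Atom) : Sequent Atom := ⟨s.ant + boxes s.unfolded, s.suc⟩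

/-- The number of symbols of a state, the unfolded boxes not being counted, so that unfolding a box
makes it smaller. -/
def weight (s : State Atom) : ℕ := (s.ant.map Formula.size).sum + (s.suc.map Formula.size).sum

/-- Refutation of a state. The unfolded formulas need to hold at proper subtrees only: what they
contribute at `t` itself has been added to the antecedent by `(refl)`. -/
def Refuted (t : Tree Atom) (s : State Atom) : Prop :=
  (∀ F ∈ s.ant, Force F t) ∧
    (∀ B ∈ s.unfolded, ∀ t', Relation.TransGen IsChild t' t → Force B t') ∧
    ∀ F ∈ s.suc, ¬ Force F t

/-- A state is valid if it is refuted at no tree. -/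
def Valid (s : State Atom) : Prop := ∀ t, ¬ s.Refuted t

/-- If `Γ` consists of atoms, none of which is in `Δ`, and `Δ` contains no implication, then
refutations of the sequents `□Π ⇒ A`, for all `□A` in `Δ`, can be joined under a new root to a
refutation of `Γ; Π ⇒ Δ`. -/
theorem not_valid_of_saturated {G P D : Multiset (Formula Atom)}
    (hG : ∀ F ∈ G, ∃ p, F = .atom p) (hGD : ∀ p, .atom p ∈ G → .atom p ∉ D)
    (hD : ∀ A B, .imp A B ∉ D) (hbox : ∀ A, .box A ∈ D → ¬ Valid ⟨boxes P, 0, {A}⟩) :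
    ¬ Valid ⟨G, P, D⟩ := by
  simp only [Valid, not_forall, not_not] at hbox ⊢
  choose c hc using hbox
  refine ⟨.node {p | Formula.atom p ∈ G} {A | Formula.box A ∈ D} fun A => c A.1 A.2, ?_, ?_, ?_⟩
  · intro F hF
    obtain ⟨p, rfl⟩ := hG F hF
    exact hF
  · intro B hB t' ht'
    obtain ⟨r, hr, hrt⟩ := Relation.TransGen.tail'_iff.1 ht'
    cases hrt with
    | intro _ _ _ i => exact (hc i.1 i.2).1 (.box B) (Multiset.mem_map_of_mem _ hB) t' hr
  · intro F hF hforce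
    cases F with
    | bot => exact hforce
    | atom p => exact hGD p hforce hF
    | imp A B => exact hD A B hF
    | box A =>
      exact (hc A hF).2.2 A (by simp)
        (hforce _ (.single (.intro _ {A | Formula.box A ∈ D} (fun A => c A.1 A.2) ⟨A, hF⟩)))

/-- One step of cut-free proof search from a valid state. -/
theorem exists_inference (s : State Atom) (hs : s.Valid) :
    ∃ r ∈ GrzInf Atom, r.conclusion = s.toSequent ∧
      ∀ (i : ℕ) q, r.premises[i]? = some q → ∃ s' : State Atom, s'.Valid ∧ s'.toSequent = q ∧
        (s'.weight < s.weight ∨ i = 1 ∧ r.IsBox) := by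
  obtain ⟨G, P, D⟩ := s
  by_cases h : Formula.bot ∈ G
  · obtain ⟨G, rfl⟩ := Multiset.exists_cons_of_mem h
    exact ⟨.botL (G + boxes P) D, id, by simp [Inference.conclusion, toSequent],
      by simp [Inference.premises]⟩
  by_cases h : ∃ p, Formula.atom p ∈ G ∧ Formula.atom p ∈ D
  · obtain ⟨p, hG, hD⟩ := h
    obtain ⟨G, rfl⟩ := Multiset.exists_cons_of_mem hG
    obtain ⟨D, rfl⟩ := Multiset.exists_cons_of_mem hD
    exact ⟨.ax (G + boxes P) D p, id, by simp [Inference.conclusion, toSequent],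
      by simp [Inference.premises]⟩
  by_cases h : ∃ A B, Formula.imp A B ∈ G
  · obtain ⟨A, B, h⟩ := h
    obtain ⟨G, rfl⟩ := Multiset.exists_cons_of_mem h
    refine ⟨.impL (G + boxes P) D A B, id, by simp [Inference.conclusion, toSequent], ?_⟩
    rintro (_ | _ | i) q hq
    · refine ⟨⟨B ::ₘ G, P, D⟩, fun t ⟨h₁, h₂, h₃⟩ => hs t ⟨?_, h₂, h₃⟩, ?_, ?_⟩
      · simp only [Multiset.mem_cons, forall_eq_or_imp] at h₁ ⊢
        exact ⟨fun _ => h₁.1, h₁.2⟩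
      · simpa [Inference.premises, toSequent] using hq
      · simp [weight, Formula.size]
    · refine ⟨⟨G, P, A ::ₘ D⟩, fun t ⟨h₁, h₂, h₃⟩ => hs t ⟨?_, h₂, ?_⟩, ?_, ?_⟩
      · simp only [Multiset.mem_cons, forall_eq_or_imp] at h₃ ⊢
        exact ⟨fun hA => (h₃.1 hA).elim, h₁⟩
      · exact fun F hF => h₃ F (Multiset.mem_cons_of_mem hF)
      · simpa [Inference.premises, toSequent] using hq
      · simp [weight, Formula.size]; omega
    · simp [Inference.premises] at hq
  by_cases h : ∃ B, Formula.box B ∈ G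
  · obtain ⟨B, h⟩ := h
    obtain ⟨G, rfl⟩ := Multiset.exists_cons_of_mem h
    refine ⟨.refl (G + boxes P) D B, id, by simp [Inference.conclusion, toSequent], ?_⟩
    rintro (_ | i) q hq
    · refine ⟨⟨B ::ₘ G, B ::ₘ P, D⟩, fun t ⟨h₁, h₂, h₃⟩ => hs t ?_, ?_, ?_⟩
      · simp only [Multiset.mem_cons, forall_eq_or_imp] at h₁ h₂
        exact ⟨by simpa using ⟨force_box_iff.2 ⟨h₁.1, h₂.1⟩, h₁.2⟩, h₂.2, h₃⟩
      · simpa [Inference.premises, toSequent, boxes, Multiset.cons_swap] using hq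
      · simp [weight, Formula.size]
    · simp [Inference.premises] at hq
  by_cases h : ∃ A B, Formula.imp A B ∈ D
  · obtain ⟨A, B, h⟩ := h
    obtain ⟨D, rfl⟩ := Multiset.exists_cons_of_mem h
    refine ⟨.impR (G + boxes P) D A B, id, by simp [Inference.conclusion, toSequent], ?_⟩
    rintro (_ | i) q hq
    · refine ⟨⟨A ::ₘ G, P, B ::ₘ D⟩, fun t ⟨h₁, h₂, h₃⟩ => hs t ?_, ?_, ?_⟩
      · simp only [Multiset.mem_cons, forall_eq_or_imp] at h₁ h₃
        exact ⟨h₁.2, h₂, by simpa using ⟨fun hAB => h₃.1 (hAB h₁.1), h₃.2⟩⟩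
      · simpa [Inference.premises, toSequent] using hq
      · simp [weight, Formula.size]; omega
    · simp [Inference.premises] at hq
  by_cases h : ∃ A, Formula.box A ∈ D ∧ Valid ⟨boxes P, 0, {A}⟩
  · obtain ⟨A, h, hA⟩ := h
    obtain ⟨D, rfl⟩ := Multiset.exists_cons_of_mem h
    refine ⟨.box G P D A, id, by simp [Inference.conclusion, toSequent], ?_⟩
    rintro (_ | _ | i) q hq
    · refine ⟨⟨G, P, A ::ₘ D⟩, fun t ⟨h₁, h₂, h₃⟩ => hs t ⟨h₁, h₂, ?_⟩, ?_, ?_⟩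
      · simp only [Multiset.mem_cons, forall_eq_or_imp] at h₃ ⊢
        exact ⟨fun hA => h₃.1 hA.of_box, h₃.2⟩
      · simpa [Inference.premises, toSequent] using hq
      · simp [weight, Formula.size]
    · exact ⟨_, hA, by simpa [Inference.premises, toSequent, boxes] using hq, .inr ⟨rfl, trivial⟩⟩
    · simp [Inference.premises] at hq
  refine (not_valid_of_saturated ?_ ?_ ?_ ?_ hs).elim
  · intro F hF
    cases F with
    | atom p => exact ⟨p, rfl⟩
    | _ => simp_all
  all_goals simp_all

end State

/-- Completeness of `Grz_∞` for well-founded trees. -/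
theorem provable_of_forall_not_refutes (s : Sequent Atom) (hs : ∀ t, ¬ Refutes t s) :
    Provable (GrzInf Atom) s := by
  have hvalid : State.Valid ⟨s.ant, 0, s.suc⟩ := fun t h => hs t ⟨h.1, h.2.2⟩
  have := provable_of_unfolding (X := {s : State Atom // s.Valid}) (S := GrzInf Atom)
    (fun x => x.1.toSequent) (fun x => x.1.weight)
    (fun x => by
      obtain ⟨r, hr, hconc, hprem⟩ := x.1.exists_inference x.2
      refine ⟨r, hr, hconc, fun i q hq => ?_⟩
      obtain ⟨s', hs', h⟩ := hprem i q hq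
      exact ⟨⟨s', hs'⟩, h⟩) ⟨_, hvalid⟩
  simpa [State.toSequent, boxes] using this

end Grz

theorem mainTheorem1 {Atom : Type*} (Γ Δ : Multiset (Grz.Formula Atom))
    (h : Grz.Provable (Grz.GrzInfCut Atom) ⟨Γ, Δ⟩) :
    Grz.Provable (Grz.GrzInf Atom) ⟨Γ, Δ⟩ := by
  obtain ⟨π, hπ⟩ := h
  refine Grz.provable_of_forall_not_refutes _ fun t ht => ?_
  exact π.sound t [] π.root π.node_nil (hπ ▸ ht)
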